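/- Let $(\Omega,\mathcal F,\mathbb P)$ be a probability space. A real-valued process $\{X_t\}_{t\ge 0}$ is called *additive* if it has (almost surely) càdlàg paths, $X_0=0$ a.s., independent increments, and is continuous in probability. An *additive subordinator* is an additive process whose paths are almost surely non-negative and non-decreasing. Let $\{W(t)\}_{t\ge0}$ be a standard Brownian motion and let $\{Z_t\}_{t\ge0}$ be an additive subordinator independent of $W$. Let $a,b,c:[0,\infty)\to\mathbb R$ be continuous functions, with $a_t>0$ for all $t$, $a$ non-decreasing, and $c_0=0$, and put $$f_t = W(a_t Z_t)+b_t Z_t+c_t ,\qquad t\ge 0 .$$ (i) If $a$ and $b$ are constant in time, then $\{f_t\}$ is an additive process. (ii) Suppose that $Z$ is non-deterministic, in the sense that for every $t>0$ the random variable $Z_t$ is not almost surely equal to a constant. Then $\{f_t\}$ is an additive process if and only if $a$ and $b$ are constant in time. -/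

import Mathlib

open MeasureTheory ProbabilityTheory Filter Topology
open scoped NNReal

/-- A path on `[0, ∞)` is càdlàg: right-continuous with finite left limits
(at time `0` the left-limit condition is vacuous). -/
def IsCadlagPath (x : ℝ≥0 → ℝ) : Prop :=
  ∀ t : ℝ≥0, ContinuousWithinAt x (Set.Ici t) t ∧ ∃ l : ℝ, Tendsto x (𝓝[<] t) (𝓝 l)

/-- A real-valued additive process: a stochastic process with almost surely càdlàg paths, started
at `0` a.s., with independent increments, and continuous in probability. -/
structure IsAdditiveProcess {Ω : Type*} [MeasurableSpace Ω] (X : ℝ≥0 → Ω → ℝ) (P : Measure Ω) :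
    Prop where
  aemeasurable : ∀ t, AEMeasurable (X t) P
  cadlag : ∀ᵐ ω ∂P, IsCadlagPath (fun t => X t ω)
  zero : ∀ᵐ ω ∂P, X 0 ω = 0
  indepIncrements : HasIndepIncrements X P
  continuousInProbability : ∀ t, TendstoInMeasure P X (𝓝 t) (X t)

/-- An additive subordinator: an additive process whose paths are almost surely nonnegative
and nondecreasing. -/
structure IsAdditiveSubordinator {Ω : Type*} [MeasurableSpace Ω] (Z : ℝ≥0 → Ω → ℝ)
    (P : Measure Ω) : Prop extends IsAdditiveProcess Z P where
  nonneg : ∀ᵐ ω ∂P, ∀ t, 0 ≤ Z t ω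
  monotone : ∀ᵐ ω ∂P, Monotone (fun t => Z t ω)

/-- The process `W(a_t Z_t) + b_t Z_t + c_t`. Times of `W` lie in `ℝ≥0`; the truncation `toNNReal`
does nothing when `a_t Z_t ≥ 0`. -/
noncomputable def subordinatedProcess {Ω : Type*} (W Z : ℝ≥0 → Ω → ℝ) (a b c : ℝ≥0 → ℝ) :
    ℝ≥0 → Ω → ℝ :=
  fun t ω => W (Real.toNNReal (a t * Z t ω)) ω + b t * Z t ω + c t

/-- A deterministic function of time is constant. -/
def IsConstantInTime (a : ℝ≥0 → ℝ) : Prop := ∃ a₀ : ℝ, ∀ t, a t = a₀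

/-- At every positive time the law of `Z` is not concentrated at a single point. -/
def IsNondeterministic {Ω : Type*} [MeasurableSpace Ω] (Z : ℝ≥0 → Ω → ℝ) (P : Measure Ω) : Prop :=
  ∀ t : ℝ≥0, 0 < t → ¬ ∃ z : ℝ, ∀ᵐ ω ∂P, Z t ω = z

/-! Conditioning on `Z` turns the joint characteristic function of the increments of `f` into an
expectation over `Z` alone (`integral_exp_sum_subordinatedProcess_increments`). If `a` and `b` are
constant, the exponent involves only increments of `Z`, so it factorizes and `f` has independent
increments; the path properties pass through continuous operations.

Conversely, for `s ≤ t` put α(u) = -u²a_s/2 + iub_s and β(v) = -v²(a_t - a_s)/2 + iv(b_t - b_s), and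
let L be the Laplace transform E exp(θ Z_s). Rewriting the exponent in Z_s and Z_t - Z_s,
independence of the increments of `f` gives L(α(u) + β(v)) = L(α(u)) L(β(v)) for small v. As L is
analytic for Re z < 0, the identity theorem replaces α(u) by any such z. Weighting by exp(-Z_s),
this makes E[exp(-Z_s) |exp(β Z_s) - L(β)|²] vanish, so exp(β Z_s) is a.s. constant
(`ae_exp_mul_eq_complexMGF`). If `a` or `b` changed between s and t, β(v) would be nonzero and tend
to 0 as v → 0, forcing Z_s to be a.s. constant. -/

/-! ### Brownian motion along independent random times -/

section TimeChange

variable {Ω : Type*} [MeasurableSpace Ω] {P : Measure Ω} {W : ℝ≥0 → Ω → ℝ}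

/-- The joint characteristic function of the increments of a Brownian motion. -/
lemma integral_exp_sum_brownian_increments (hW : IsPreBrownianReal W P) {n : ℕ}
    {s : Fin (n + 1) → ℝ≥0} (hs : Monotone s) (u : Fin n → ℝ) :
    ∫ ω, Complex.exp (Complex.I *
        ((∑ k, u k * (W (s k.succ) ω - W (s k.castSucc) ω) : ℝ) : ℂ)) ∂P =
      Complex.exp ((-∑ k, u k ^ 2 * ((s k.succ : ℝ) - s k.castSucc) / 2 : ℝ) : ℂ) := by
  have hind := hW.hasIndepIncrements n s hs
  have hm : ∀ k : Fin n, AEMeasurable (fun ω => W (s k.succ) ω - W (s k.castSucc) ω) P :=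
    fun k => (hW.aemeasurable _).sub (hW.aemeasurable _)
  have hprod := hind.integral_fun_prod_comp
    (f := fun k (x : ℝ) => Complex.exp (u k * x * Complex.I)) hm
    (fun k => by fun_prop)
  have hone : ∀ k : Fin n, ∫ ω, Complex.exp (u k * ((W (s k.succ) ω - W (s k.castSucc) ω : ℝ) : ℂ)
      * Complex.I) ∂P =
      Complex.exp ((-(u k ^ 2 * ((s k.succ : ℝ) - s k.castSucc) / 2) : ℝ) : ℂ) := by
    intro k
    have hlaw := hW.hasLaw_sub (s k.succ) (s k.castSucc)
    have h1 := hlaw.integral_comp (f := fun x : ℝ => Complex.exp (u k * x * Complex.I))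
      (by fun_prop)
    have h2 := charFun_gaussianReal (μ := 0) (v := nndist (s k.succ : ℝ) (s k.castSucc)) (u k)
    rw [charFun_apply_real] at h2
    have h3 : ((nndist (s k.succ : ℝ) (s k.castSucc) : ℝ≥0) : ℝ)
        = (s k.succ : ℝ) - s k.castSucc := by
      rw [coe_nndist, Real.dist_eq, abs_of_nonneg]
      exact sub_nonneg.2 (NNReal.coe_le_coe.2 (hs (Fin.castSucc_le_succ k)))
    refine h1.trans (h2.trans ?_)
    rw [h3]
    congr 1
    push_cast
    ring
  calc _ = ∫ ω, ∏ k, Complex.exp (u k * ((W (s k.succ) ω - W (s k.castSucc) ω : ℝ) : ℂ)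
      * Complex.I) ∂P := by
        congr with ω
        rw [← Complex.exp_sum]
        congr 1
        push_cast
        rw [Finset.mul_sum]
        exact Finset.sum_congr rfl fun k _ => by ring
    _ = _ := hprod
    _ = _ := by
        rw [Finset.prod_congr rfl fun k _ => hone k, ← Complex.exp_sum]
        congr 1
        push_cast
        rw [← Finset.sum_neg_distrib]

/-- Rounding a nonnegative real down to the grid of mesh `1 / (m + 1)`. -/
noncomputable def gridFloor (m : ℕ) (x : ℝ≥0) : ℝ≥0 := (⌊x * (m + 1)⌋₊ : ℝ≥0) / (m + 1)

lemma tendsto_gridFloor (x : ℝ≥0) : Tendsto (fun m => gridFloor m x) atTop (𝓝 x) := by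
  rw [← NNReal.tendsto_coe]
  have h := (tendsto_nat_floor_mul_div_atTop (R := ℝ) x.2).comp
    (tendsto_natCast_atTop_atTop.comp (tendsto_add_atTop_nat 1))
  refine h.congr fun m => ?_
  simp only [Function.comp_apply, gridFloor, NNReal.coe_div, NNReal.coe_natCast, NNReal.coe_add,
    NNReal.coe_one, Nat.cast_add, Nat.cast_one]
  congr 2

lemma monotone_gridFloor (m : ℕ) : Monotone (gridFloor m) := by
  intro x y hxy
  unfold gridFloor
  gcongr

/-- Joint measurability of evaluation relies on a countable index set; it fails on the product space
over `ℝ≥0`, which is why clocks are first rounded to a grid. -/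
lemma measurable_eval_nat : Measurable (fun p : (ℕ → ℝ) × ℕ => p.1 p.2) :=
  measurable_from_prod_countable_left fun k => measurable_pi_apply k

lemma aemeasurable_time_change_gridFloor (hW : ∀ t, AEMeasurable (W t) P) {τ : Ω → ℝ≥0}
    (hτ : AEMeasurable τ P) (m : ℕ) : AEMeasurable (fun ω => W (gridFloor m (τ ω)) ω) P := by
  have h1 : AEMeasurable (fun ω => fun k : ℕ => W ((k : ℝ≥0) / (m + 1)) ω) P :=
    aemeasurable_pi_iff.2 fun k => hW _
  have h2 : AEMeasurable (fun ω => ⌊τ ω * (m + 1)⌋₊) P :=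
    Nat.measurable_floor.comp_aemeasurable (hτ.mul_const _)
  exact measurable_eval_nat.comp_aemeasurable (h1.prodMk h2)

lemma aemeasurable_time_change (hW : ∀ t, AEMeasurable (W t) P)
    (hc : ∀ᵐ ω ∂P, Continuous (W · ω)) {τ : Ω → ℝ≥0} (hτ : AEMeasurable τ P) :
    AEMeasurable (fun ω => W (τ ω) ω) P := by
  refine aemeasurable_of_tendsto_metrizable_ae atTop
    (fun m => aemeasurable_time_change_gridFloor hW hτ m) ?_
  filter_upwards [hc] with ω hω
  exact (hω.tendsto _).comp (tendsto_gridFloor _)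

variable {E : Type*} [MeasurableSpace E] [IsProbabilityMeasure P]

/-- On a grid only countably many values of `W` matter; they are independent of `T`, so Fubini
freezes the clock and leaves deterministic Brownian times. The bounded factor `H` will carry the
drift. -/
lemma integral_exp_time_change_gridFloor_mul (hW : IsPreBrownianReal W P) {T : Ω → E}
    (hT : AEMeasurable T P) (hWT : IndepFun (fun ω t => W t ω) T P) {n : ℕ}
    {τ : Fin (n + 1) → E → ℝ≥0} (hτ : ∀ k, Measurable (τ k))
    (hmono : ∀ᵐ ω ∂P, Monotone fun k => τ k (T ω)) (u : Fin n → ℝ) {H : E → ℂ}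
    (hH : Measurable H) (hH1 : ∀ x, ‖H x‖ ≤ 1) (m : ℕ) :
    ∫ ω, Complex.exp (Complex.I * ((∑ k, u k * (W (gridFloor m (τ k.succ (T ω))) ω -
        W (gridFloor m (τ k.castSucc (T ω))) ω) : ℝ) : ℂ)) * H (T ω) ∂P =
      ∫ ω, Complex.exp ((-∑ k, u k ^ 2 * ((gridFloor m (τ k.succ (T ω)) : ℝ) -
        gridFloor m (τ k.castSucc (T ω))) / 2 : ℝ) : ℂ) * H (T ω) ∂P := by
  set V : Ω → ℕ → ℝ := fun ω k => W ((k : ℝ≥0) / (m + 1)) ω with hV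
  have hVm : AEMeasurable V P := aemeasurable_pi_iff.2 fun k => hW.aemeasurable _
  have hind : IndepFun V T P :=
    hWT.comp (φ := fun w (k : ℕ) => w ((k : ℝ≥0) / (m + 1))) (ψ := id)
      (measurable_pi_iff.2 fun k => measurable_pi_apply _) measurable_id
  have hmap := (indepFun_iff_map_prod_eq_prod_map_map hVm hT).1 hind
  let N : Fin (n + 1) → E → ℕ := fun k x => ⌊τ k x * (m + 1)⌋₊
  have hN : ∀ k, Measurable (N k) := fun k => Nat.measurable_floor.comp ((hτ k).mul_const _)
  let G : (ℕ → ℝ) × E → ℂ := fun p => Complex.exp (Complex.I *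
    ((∑ k : Fin n, u k * (p.1 (N k.succ p.2) - p.1 (N k.castSucc p.2)) : ℝ) : ℂ)) * H p.2
  have heval : ∀ k, Measurable fun p : (ℕ → ℝ) × E => p.1 (N k p.2) := fun k =>
    measurable_eval_nat.comp (measurable_fst.prodMk ((hN k).comp measurable_snd))
  have hG : Measurable G := by
    refine Measurable.mul ?_ (hH.comp measurable_snd)
    refine Complex.measurable_exp.comp (Measurable.const_mul (Complex.measurable_ofReal.comp ?_) _)
    exact Finset.measurable_sum _ fun k _ =>
      ((heval k.succ).sub (heval k.castSucc)).const_mul _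
  have hGb : ∀ p, ‖G p‖ ≤ 1 := by
    intro p
    simp only [G, norm_mul, mul_comm Complex.I, Complex.norm_exp_ofReal_mul_I, one_mul]
    exact hH1 _
  have := Measure.isProbabilityMeasure_map (μ := P) hVm
  have := Measure.isProbabilityMeasure_map (μ := P) hT
  have hGi : Integrable G ((P.map V).prod (P.map T)) :=
    Integrable.of_bound hG.aestronglyMeasurable 1 (Eventually.of_forall hGb)
  have hinner : ∀ᵐ x ∂(P.map T), ∫ v, G (v, x) ∂(P.map V) =
      Complex.exp ((-∑ k : Fin n, u k ^ 2 * ((gridFloor m (τ k.succ x) : ℝ) -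
        gridFloor m (τ k.castSucc x)) / 2 : ℝ) : ℂ) * H x := by
    have hmono' : ∀ᵐ x ∂(P.map T), ∀ i j : Fin (n + 1), i ≤ j → τ i x ≤ τ j x := by
      rw [ae_all_iff]
      intro i
      rw [ae_all_iff]
      intro j
      rw [ae_map_iff hT]
      · filter_upwards [hmono] with ω hω using fun hij => hω hij
      · by_cases hij : i ≤ j
        · simpa [hij] using measurableSet_le (hτ i) (hτ j)
        · simp [hij]
    filter_upwards [hmono'] with x hx
    have hGx : Measurable fun v => G (v, x) := hG.comp measurable_prodMk_right
    rw [integral_map hVm hGx.aestronglyMeasurable]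
    have hmon : Monotone fun k => gridFloor m (τ k x) :=
      fun i j hij => monotone_gridFloor m (hx i j hij)
    rw [← integral_exp_sum_brownian_increments hW hmon u, ← integral_mul_const]
    rfl
  calc _ = ∫ ω, G (V ω, T ω) ∂P := rfl
    _ = ∫ p, G p ∂(P.map fun ω => (V ω, T ω)) :=
        (integral_map (hVm.prodMk hT) hG.aestronglyMeasurable).symm
    _ = ∫ x, ∫ v, G (v, x) ∂(P.map V) ∂(P.map T) := by
        rw [hmap, integral_prod_symm _ hGi]
    _ = _ := by
        rw [integral_congr_ae hinner, integral_map hT]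
        refine Measurable.aestronglyMeasurable ?_
        have hgm : ∀ k, Measurable fun x => gridFloor m (τ k x) := fun k =>
          (monotone_gridFloor m).measurable.comp (hτ k)
        fun_prop

/-- Conditioning on the clock: the joint characteristic function of the increments of a Brownian
motion along random times that are independent of it. -/
lemma integral_exp_time_change_mul (hW : IsBrownianReal W P) {T : Ω → E}
    (hT : AEMeasurable T P) (hWT : IndepFun (fun ω t => W t ω) T P) {n : ℕ}
    {τ : Fin (n + 1) → E → ℝ≥0} (hτ : ∀ k, Measurable (τ k))
    (hmono : ∀ᵐ ω ∂P, Monotone fun k => τ k (T ω)) (u : Fin n → ℝ) {H : E → ℂ}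
    (hH : Measurable H) (hH1 : ∀ x, ‖H x‖ ≤ 1) :
    ∫ ω, Complex.exp (Complex.I * ((∑ k, u k * (W (τ k.succ (T ω)) ω -
        W (τ k.castSucc (T ω)) ω) : ℝ) : ℂ)) * H (T ω) ∂P =
      ∫ ω, Complex.exp ((-∑ k, u k ^ 2 * ((τ k.succ (T ω) : ℝ) -
        τ k.castSucc (T ω)) / 2 : ℝ) : ℂ) * H (T ω) ∂P := by
  have hτT : ∀ k, AEMeasurable (fun ω => τ k (T ω)) P := fun k => (hτ k).comp_aemeasurable hT
  have hHT : AEMeasurable (fun ω => H (T ω)) P := hH.comp_aemeasurable hT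
  -- Both sides are limits of the grid identity: path continuity handles the left, monotonicity of
  -- the clock keeps the Gaussian factor on the right bounded by 1.
  refine tendsto_nhds_unique
    (f := fun m => ∫ ω, Complex.exp (Complex.I * ((∑ k, u k * (W (gridFloor m (τ k.succ (T ω))) ω -
        W (gridFloor m (τ k.castSucc (T ω))) ω) : ℝ) : ℂ)) * H (T ω) ∂P) (l := atTop) ?_ ?_
  · refine tendsto_integral_of_dominated_convergence (fun _ => 1) (fun m => ?_)
      (integrable_const _) (fun m => Eventually.of_forall fun ω => ?_) ?_
    · have h := fun k =>
        aemeasurable_time_change_gridFloor hW.toIsPreBrownianReal.aemeasurable (hτT k) m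
      refine AEMeasurable.aestronglyMeasurable ?_
      refine AEMeasurable.mul ?_ hHT
      refine Complex.measurable_exp.comp_aemeasurable (AEMeasurable.const_mul
        (Complex.measurable_ofReal.comp_aemeasurable ?_) _)
      exact Finset.aemeasurable_fun_sum _ fun k _ => ((h k.succ).sub (h k.castSucc)).const_mul _
    · simp only [norm_mul, mul_comm Complex.I, Complex.norm_exp_ofReal_mul_I, one_mul]
      exact hH1 _
    · filter_upwards [hW.cont] with ω hω
      have h : ∀ k, Tendsto (fun m => W (gridFloor m (τ k (T ω))) ω) atTop
          (𝓝 (W (τ k (T ω)) ω)) := fun k => (hω.tendsto _).comp (tendsto_gridFloor _)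
      refine Tendsto.mul_const _ ((Complex.continuous_exp.tendsto _).comp
        (Tendsto.const_mul _ ((Complex.continuous_ofReal.tendsto _).comp ?_)))
      exact tendsto_finsetSum _ fun k _ => ((h k.succ).sub (h k.castSucc)).const_mul _
  · simp_rw [integral_exp_time_change_gridFloor_mul hW.toIsPreBrownianReal hT hWT hτ hmono u hH hH1]
    have hgm : ∀ m k, AEMeasurable (fun ω => (gridFloor m (τ k (T ω)) : ℝ)) P := fun m k =>
      ((monotone_gridFloor m).measurable.comp_aemeasurable (hτT k)).coe_nnreal_real
    refine tendsto_integral_of_dominated_convergence (fun _ => 1) (fun m => ?_)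
      (integrable_const _) (fun m => ?_) (Eventually.of_forall fun ω => ?_)
    · refine AEMeasurable.aestronglyMeasurable ?_
      refine AEMeasurable.mul ?_ hHT
      refine Complex.measurable_exp.comp_aemeasurable
        (Complex.measurable_ofReal.comp_aemeasurable (AEMeasurable.neg ?_))
      exact Finset.aemeasurable_fun_sum _ fun k _ =>
        (((hgm m k.succ).sub (hgm m k.castSucc)).const_mul _).div_const _
    · filter_upwards [hmono] with ω hω
      rw [norm_mul, Complex.norm_exp, Complex.ofReal_re]
      refine mul_le_one₀ (Real.exp_le_one_iff.2 ?_) (norm_nonneg _) (hH1 _)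
      refine neg_nonpos.2 (Finset.sum_nonneg fun k _ => ?_)
      have : (gridFloor m (τ k.castSucc (T ω)) : ℝ) ≤ gridFloor m (τ k.succ (T ω)) :=
        NNReal.coe_le_coe.2 (monotone_gridFloor m (hω (Fin.castSucc_le_succ k)))
      have := sub_nonneg.2 this
      positivity
    · have h : ∀ k, Tendsto (fun m => (gridFloor m (τ k (T ω)) : ℝ)) atTop
          (𝓝 (τ k (T ω))) := fun k => NNReal.tendsto_coe.2 (tendsto_gridFloor _)
      refine Tendsto.mul_const _ ((Complex.continuous_exp.tendsto _).comp
        ((Complex.continuous_ofReal.tendsto _).comp (Tendsto.neg ?_)))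
      exact tendsto_finsetSum _ fun k _ =>
        (((h k.succ).sub (h k.castSucc)).const_mul _).div_const _

end TimeChange

/-! ### The subordinated process and sufficiency of constant coefficients -/

section Subordination

variable {Ω : Type*} [MeasurableSpace Ω] {P : Measure Ω} {W Z : ℝ≥0 → Ω → ℝ} {a b c : ℝ≥0 → ℝ}

lemma aemeasurable_subordinatedProcess (hW : IsBrownianReal W P) (hZ : ∀ t, AEMeasurable (Z t) P)
    (t : ℝ≥0) : AEMeasurable (subordinatedProcess W Z a b c t) P := by
  have h1 : AEMeasurable (fun ω => W (Real.toNNReal (a t * Z t ω)) ω) P :=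
    aemeasurable_time_change hW.toIsPreBrownianReal.aemeasurable hW.cont
      ((hZ t).const_mul _).real_toNNReal
  exact (h1.add ((hZ t).const_mul _)).add_const _

/-- The joint characteristic function of the increments of the subordinated process, as an
expectation over the subordinator alone. -/
lemma integral_exp_sum_subordinatedProcess_increments [IsProbabilityMeasure P]
    (hW : IsBrownianReal W P) (hZ : IsAdditiveSubordinator Z P)
    (hWZ : IndepFun (fun ω t => W t ω) (fun ω t => Z t ω) P)
    (ha_pos : ∀ t, 0 < a t) (ha_mono : Monotone a) {n : ℕ} {t : Fin (n + 1) → ℝ≥0}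
    (ht : Monotone t) (u : Fin n → ℝ) :
    ∫ ω, Complex.exp (Complex.I * ((∑ k, u k * (subordinatedProcess W Z a b c (t k.succ) ω -
        subordinatedProcess W Z a b c (t k.castSucc) ω) : ℝ) : ℂ)) ∂P =
      ∫ ω, Complex.exp (∑ k, (-(u k : ℂ) ^ 2 / 2 *
          (a (t k.succ) * Z (t k.succ) ω - a (t k.castSucc) * Z (t k.castSucc) ω) +
        Complex.I * u k *
          (b (t k.succ) * Z (t k.succ) ω - b (t k.castSucc) * Z (t k.castSucc) ω +
            (c (t k.succ) - c (t k.castSucc))))) ∂P := by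
  let T : Ω → Fin (n + 1) → ℝ := fun ω k => Z (t k) ω
  let τ : Fin (n + 1) → (Fin (n + 1) → ℝ) → ℝ≥0 := fun k x => Real.toNNReal (a (t k) * x k)
  let H : (Fin (n + 1) → ℝ) → ℂ := fun x => Complex.exp (((∑ k : Fin n, u k *
    (b (t k.succ) * x k.succ - b (t k.castSucc) * x k.castSucc +
      (c (t k.succ) - c (t k.castSucc))) : ℝ) : ℂ) * Complex.I)
  have hT : AEMeasurable T P := aemeasurable_pi_iff.2 fun k => hZ.aemeasurable _
  have hWT : IndepFun (fun ω t => W t ω) T P :=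
    hWZ.comp (φ := id) (ψ := fun (z : ℝ≥0 → ℝ) (k : Fin (n + 1)) => z (t k)) measurable_id
      (measurable_pi_iff.2 fun k => measurable_pi_apply _)
  have hτ : ∀ k, Measurable (τ k) := fun k =>
    ((measurable_pi_apply k).const_mul _).real_toNNReal
  have hmono : ∀ᵐ ω ∂P, Monotone fun k => τ k (T ω) := by
    filter_upwards [hZ.nonneg, hZ.monotone] with ω h0 hm i j hij
    exact Real.toNNReal_le_toNNReal
      (mul_le_mul (ha_mono (ht hij)) (hm (ht hij)) (h0 _) (ha_pos _).le)
  have hH : Measurable H := by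
    refine Complex.measurable_exp.comp (Measurable.mul_const (Complex.measurable_ofReal.comp ?_) _)
    fun_prop
  have hH1 : ∀ x, ‖H x‖ ≤ 1 := fun x => (Complex.norm_exp_ofReal_mul_I _).le
  have key := integral_exp_time_change_mul hW hT hWT hτ hmono u hH hH1
  refine Eq.trans ?_ (key.trans ?_)
  · congr with ω
    rw [← Complex.exp_add]
    congr 1
    rw [mul_comm _ Complex.I, ← mul_add, ← Complex.ofReal_add, ← Finset.sum_add_distrib]
    congr 2
    refine Finset.sum_congr rfl fun k _ => ?_
    simp only [subordinatedProcess, τ, T]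
    ring
  · refine integral_congr_ae ?_
    filter_upwards [hZ.nonneg] with ω h0
    rw [← Complex.exp_add]
    congr 1
    have hval : ∀ k, (τ k (T ω) : ℝ) = a (t k) * Z (t k) ω := fun k =>
      Real.coe_toNNReal _ (mul_nonneg (ha_pos _).le (h0 _))
    simp only [hval]
    push_cast
    rw [← Finset.sum_neg_distrib, Finset.sum_mul, ← Finset.sum_add_distrib]
    refine Finset.sum_congr rfl fun k _ => ?_
    simp only [T]
    ring

/-- Independence of the coordinates follows from any factorization of the joint characteristic
function into functions of the single coordinates. -/
lemma iIndepFun_of_integral_exp_eq_prod [IsProbabilityMeasure P] {n : ℕ} {X : Fin n → Ω → ℝ}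
    (hX : ∀ k, AEMeasurable (X k) P) (φ : Fin n → ℝ → ℂ) (hφ : ∀ k, φ k 0 = 1)
    (h : ∀ u : Fin n → ℝ, ∫ ω, Complex.exp (Complex.I * ((∑ k, u k * X k ω : ℝ) : ℂ)) ∂P =
      ∏ k, φ k (u k)) : iIndepFun X P := by
  have hone : ∀ k x, charFun (P.map (X k)) x = φ k x := by
    intro k x
    -- Testing on a single coordinate, where the other factors are 1, identifies `φ k` as the
    -- characteristic function of `X k`.
    have h1 := h (Pi.single k x)
    rw [Finset.prod_eq_single k (fun j _ hj => by simp [Pi.single_eq_of_ne hj, hφ]) (by simp),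
      Pi.single_eq_same] at h1
    rw [charFun_apply_real, integral_map (hX k) (by fun_prop), ← h1]
    congr with ω
    rw [Finset.sum_eq_single k (fun j _ hj => by simp [Pi.single_eq_of_ne hj]) (by simp),
      Pi.single_eq_same]
    push_cast
    ring_nf
  rw [iIndepFun_iff_charFun_pi hX]
  intro u
  rw [Finset.prod_congr rfl fun k _ => hone k (u k), ← h (fun k => u k), charFun_apply,
    integral_map (by fun_prop) (by fun_prop)]
  congr with ω
  rw [mul_comm]
  simp [PiLp.inner_apply, mul_comm]

/-- With constant coefficients each summand of the exponent depends on one increment of `Z` only, so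
independence of those increments factorizes the expectation. -/
lemma hasIndepIncrements_subordinatedProcess [IsProbabilityMeasure P]
    (hW : IsBrownianReal W P) (hZ : IsAdditiveSubordinator Z P)
    (hWZ : IndepFun (fun ω t => W t ω) (fun ω t => Z t ω) P) {a₀ b₀ : ℝ} (ha₀ : 0 < a₀) :
    HasIndepIncrements (subordinatedProcess W Z (fun _ => a₀) (fun _ => b₀) c) P := by
  intro n t ht
  have hm := fun t => aemeasurable_subordinatedProcess (a := fun _ => a₀) (b := fun _ => b₀)
    (c := c) hW hZ.aemeasurable t
  let g : Fin n → ℝ → ℝ → ℂ := fun k x z => Complex.exp (-(x : ℂ) ^ 2 / 2 * (a₀ * z) +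
    Complex.I * x * (b₀ * z + (c (t k.succ) - c (t k.castSucc))))
  refine iIndepFun_of_integral_exp_eq_prod (fun k => (hm _).sub (hm _))
    (fun k x => ∫ ω, g k x (Z (t k.succ) ω - Z (t k.castSucc) ω) ∂P) (fun k => ?_) fun u => ?_
  · simp [g]
  · rw [integral_exp_sum_subordinatedProcess_increments hW hZ hWZ (fun _ => ha₀) monotone_const ht]
    have h := (hZ.indepIncrements n t ht).integral_fun_prod_comp (f := fun k => g k (u k))
      (fun k => (hZ.aemeasurable _).sub (hZ.aemeasurable _)) (fun k => by fun_prop)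
    refine Eq.trans ?_ h
    congr with ω
    rw [← Complex.exp_sum]
    congr 1
    refine Finset.sum_congr rfl fun k _ => ?_
    push_cast
    ring

lemma isCadlagPath_subordinated {w z : ℝ≥0 → ℝ} (hw : Continuous w) (hz : IsCadlagPath z)
    (ha : Continuous a) (hb : Continuous b) (hc : Continuous c) :
    IsCadlagPath fun t => w (Real.toNNReal (a t * z t)) + b t * z t + c t := by
  have hlim : ∀ (t : ℝ≥0) (l : Filter ℝ≥0) (y : ℝ), l ≤ 𝓝 t → Tendsto z l (𝓝 y) →
      Tendsto (fun t => w (Real.toNNReal (a t * z t)) + b t * z t + c t) l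
        (𝓝 (w (Real.toNNReal (a t * y)) + b t * y + c t)) := fun t l y hl hy =>
    (((hw.tendsto _).comp ((continuous_real_toNNReal.tendsto _).comp
      (((ha.tendsto t).mono_left hl).mul hy))).add (((hb.tendsto t).mono_left hl).mul hy)).add
      ((hc.tendsto t).mono_left hl)
  intro t
  obtain ⟨h1, l, h2⟩ := hz t
  exact ⟨hlim t _ _ nhdsWithin_le_nhds h1, _, hlim t _ l nhdsWithin_le_nhds h2⟩

/-- Along any sequence of times, a subsequence makes `Z` converge almost surely, and continuity of
the Brownian path and of the coefficients transfers this to the process. -/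
lemma tendstoInMeasure_subordinatedProcess [IsProbabilityMeasure P]
    (hW : IsBrownianReal W P) (hZm : ∀ t, AEMeasurable (Z t) P)
    (ha : Continuous a) (hb : Continuous b) (hc : Continuous c) {t : ℝ≥0}
    (hZ : TendstoInMeasure P Z (𝓝 t) (Z t)) :
    TendstoInMeasure P (subordinatedProcess W Z a b c) (𝓝 t)
      (subordinatedProcess W Z a b c t) := by
  have hm := fun t => aemeasurable_subordinatedProcess (a := a) (b := b) (c := c) hW hZm t
  intro ε hε
  refine tendsto_of_seq_tendsto fun s hs => ?_
  have hseq : TendstoInMeasure P (fun n => subordinatedProcess W Z a b c (s n)) atTop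
      (subordinatedProcess W Z a b c t) := by
    rw [exists_seq_tendstoInMeasure_atTop_iff fun n => (hm _).aestronglyMeasurable]
    intro ns hns
    have hsn : Tendsto (fun i => s (ns i)) atTop (𝓝 t) := hs.comp hns.tendsto_atTop
    obtain ⟨ns', hns', hae⟩ := (hZ.comp hsn).exists_seq_tendsto_ae
    refine ⟨ns', hns', ?_⟩
    filter_upwards [hW.cont, hae] with ω hω hz
    have hst : Tendsto (fun i => s (ns (ns' i))) atTop (𝓝 t) := hsn.comp hns'.tendsto_atTop
    exact (((hω.tendsto _).comp ((continuous_real_toNNReal.tendsto _).comp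
      (((ha.tendsto t).comp hst).mul hz))).add (((hb.tendsto t).comp hst).mul hz)).add
      ((hc.tendsto t).comp hst)
  exact hseq ε hε

/-- Time-changing a Brownian motion with drift by an additive subordinator yields an additive
process. -/
theorem isAdditiveProcess_subordinatedProcess_const [IsProbabilityMeasure P]
    (hW : IsBrownianReal W P) (hZ : IsAdditiveSubordinator Z P)
    (hWZ : IndepFun (fun ω t => W t ω) (fun ω t => Z t ω) P) {a₀ : ℝ} (b₀ : ℝ) (ha₀ : 0 < a₀)
    (hc : Continuous c) (hc0 : c 0 = 0) :
    IsAdditiveProcess (subordinatedProcess W Z (fun _ => a₀) (fun _ => b₀) c) P where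
  aemeasurable := aemeasurable_subordinatedProcess hW hZ.aemeasurable
  cadlag := by
    filter_upwards [hW.cont, hZ.cadlag] with ω hw hz
    exact isCadlagPath_subordinated hw hz continuous_const continuous_const hc
  zero := by
    filter_upwards [hW.toIsPreBrownianReal.eval_zero_ae_eq_zero, hZ.zero] with ω hw hz
    simp [subordinatedProcess, hw, hz, hc0]
  indepIncrements := hasIndepIncrements_subordinatedProcess hW hZ hWZ ha₀
  continuousInProbability t := tendstoInMeasure_subordinatedProcess hW hZ.aemeasurable
    continuous_const continuous_const hc (hZ.continuousInProbability t)

end Subordination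

/-! ### Laplace transforms of nonnegative variables and rigidity -/

section LaplaceTransform

lemma gaussian_exponent_eq (v p q : ℝ) : -(v : ℂ) ^ 2 / 2 * p + Complex.I * v * q =
    ((-v ^ 2 / 2 * p : ℝ) : ℂ) + ((v * q : ℝ) : ℂ) * Complex.I := by
  push_cast
  ring

lemma re_gaussian_exponent (v p q : ℝ) :
    (-(v : ℂ) ^ 2 / 2 * p + Complex.I * v * q).re = -v ^ 2 / 2 * p := by
  rw [gaussian_exponent_eq, Complex.add_re, Complex.ofReal_re, Complex.re_ofReal_mul, Complex.I_re,
    mul_zero, add_zero]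

lemma im_gaussian_exponent (v p q : ℝ) :
    (-(v : ℂ) ^ 2 / 2 * p + Complex.I * v * q).im = v * q := by
  rw [gaussian_exponent_eq, Complex.add_im, Complex.ofReal_im, Complex.im_ofReal_mul, Complex.I_im,
    mul_one, zero_add]

variable {Ω : Type*} [MeasurableSpace Ω] {P : Measure Ω} {Y : Ω → ℝ}

lemma complexMGF_starRingEnd (θ : ℂ) :
    complexMGF Y P (starRingEnd ℂ θ) = starRingEnd ℂ (complexMGF Y P θ) := by
  simp only [complexMGF]
  rw [← integral_conj]
  congr with ω
  rw [← Complex.exp_conj, map_mul, Complex.conj_ofReal]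

variable [IsProbabilityMeasure P]

lemma norm_exp_mul_le_one {θ : ℂ} (hθ : θ.re ≤ 0) {y : ℝ} (hy : 0 ≤ y) :
    ‖Complex.exp (θ * y)‖ ≤ 1 := by
  rw [Complex.norm_exp, Complex.re_mul_ofReal]
  exact Real.exp_le_one_iff.2 (mul_nonpos_of_nonpos_of_nonneg hθ hy)

lemma integrable_exp_mul_of_nonneg (hY : AEMeasurable Y P) (hY0 : ∀ᵐ ω ∂P, 0 ≤ Y ω) {θ : ℂ}
    (hθ : θ.re ≤ 0) : Integrable (fun ω => Complex.exp (θ * Y ω)) P := by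
  refine Integrable.of_bound (by fun_prop) 1 ?_
  filter_upwards [hY0] with ω hω using norm_exp_mul_le_one hθ hω

lemma re_mem_interior_integrableExpSet (hY : AEMeasurable Y P) (hY0 : ∀ᵐ ω ∂P, 0 ≤ Y ω) {θ : ℂ}
    (hθ : θ.re < 0) : θ.re ∈ interior (integrableExpSet Y P) := by
  have hsub : Set.Iio (0 : ℝ) ⊆ integrableExpSet Y P := by
    intro x hx
    have := (integrable_exp_mul_of_nonneg hY hY0 (θ := (x : ℂ)) (by simpa using hx.le)).re
    refine this.congr (Eventually.of_forall fun ω => ?_)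
    simp [← Complex.ofReal_mul, ← Complex.ofReal_exp]
  exact interior_maximal hsub isOpen_Iio hθ

/-- If the Laplace transform of a nonnegative random variable is multiplicative with respect to the
shift by `β`, on a curve accumulating in the open left half-plane, then `exp (β Y)` is almost surely
constant. -/
lemma ae_exp_mul_eq_complexMGF (hY : AEMeasurable Y P) (hY0 : ∀ᵐ ω ∂P, 0 ≤ Y ω) {β : ℂ}
    (hβ : β.re ≤ 0) {a b : ℝ} (ha : 0 < a)
    (h : ∀ u : ℝ, complexMGF Y P (-(u : ℂ) ^ 2 / 2 * a + Complex.I * u * b + β) =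
      complexMGF Y P (-(u : ℂ) ^ 2 / 2 * a + Complex.I * u * b) * complexMGF Y P β) :
    ∀ᵐ ω ∂P, Complex.exp (β * Y ω) = complexMGF Y P β := by
  set L := complexMGF Y P with hL
  set U : Set ℂ := {z | z.re < 0} with hU
  let α : ℝ → ℂ := fun u => -(u : ℂ) ^ 2 / 2 * a + Complex.I * u * b
  have hαre : ∀ u, (α u).re = -u ^ 2 / 2 * a := fun u => re_gaussian_exponent u a b
  have hana : ∀ z ∈ U, AnalyticAt ℂ L z := fun z hz =>
    analyticAt_complexMGF (re_mem_interior_integrableExpSet hY hY0 hz)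
  have hEq : Set.EqOn (fun z => L (z + β)) (fun z => L z * L β) U := by
    -- The identity theorem is applied at `α 1`. For u > 0 the real part -u²a/2 determines u, so the
    -- points `α u` accumulate there without hitting it.
    refine AnalyticOnNhd.eqOn_of_preconnected_of_frequently_eq (z₀ := α 1) ?_ ?_ ?_ ?_ ?_
    · intro z hz
      have hz' : z + β ∈ U := by
        have : z.re < 0 := hz
        simp only [hU, Set.mem_ofPred_eq, Complex.add_re]
        linarith
      exact AnalyticAt.fun_comp (g := L) (f := fun z => z + β) (hana _ hz')
        (analyticAt_id.add analyticAt_const)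
    · exact fun z hz => (hana z hz).mul analyticAt_const
    · exact (convex_halfSpace_re_lt 0).isPreconnected
    · simp only [hU, Set.mem_ofPred_eq, hαre]
      linarith
    · have hcont : Continuous α := by fun_prop
      have htend : Tendsto α (𝓝[≠] 1) (𝓝[≠] (α 1)) := by
        refine tendsto_nhdsWithin_iff.2 ⟨(hcont.tendsto 1).mono_left nhdsWithin_le_nhds, ?_⟩
        filter_upwards [self_mem_nhdsWithin,
          nhdsWithin_le_nhds (Ioi_mem_nhds (zero_lt_one (α := ℝ)))] with u hu hu0 hEq
        have hre := congrArg Complex.re hEq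
        rw [hαre, hαre] at hre
        have h2 : u ^ 2 = 1 := by
          have : (u ^ 2 - 1) * a = 0 := by linarith
          rcases mul_eq_zero.1 this with h | h
          · linarith
          · exact absurd h ha.ne'
        have hu0' : (0 : ℝ) < u := hu0
        exact hu ((pow_eq_one_iff_of_nonneg hu0'.le two_ne_zero).1 h2)
      exact htend.frequently (Eventually.of_forall (f := 𝓝[≠] (1 : ℝ)) h).frequently
  set l := L β with hl
  -- The base point -1 keeps every argument in the open half-plane, even when Re β = 0.
  have hneg : (-1 : ℂ) ∈ U := by simp [hU]
  have hβ' : (starRingEnd ℂ β).re ≤ 0 := by simpa using hβ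
  have e1 : L (-1 + β) = L (-1) * l := hEq hneg
  -- Multiplicativity is known only for the shift by β; the conjugate shift follows by symmetry, as
  -- `L (-1)` is real.
  have e2 : L (-1 + starRingEnd ℂ β) = L (-1) * starRingEnd ℂ l := by
    have h1 : starRingEnd ℂ (-1 + β) = -1 + starRingEnd ℂ β := by simp
    have h2 : starRingEnd ℂ (L (-1)) = L (-1) := by
      rw [hL, ← complexMGF_starRingEnd]; simp
    rw [← h1, hL, complexMGF_starRingEnd, ← hL, e1, map_mul, h2]
  have e3 : L (-1 + starRingEnd ℂ β + β) = L (-1 + starRingEnd ℂ β) * l := by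
    refine hEq ?_
    simp only [hU, Set.mem_ofPred_eq, Complex.add_re, Complex.neg_re, Complex.one_re]
    linarith
  have hint : ∀ θ : ℂ, θ.re ≤ 0 → Integrable (fun ω => Complex.exp (θ * Y ω)) P :=
    fun θ hθ => integrable_exp_mul_of_nonneg hY hY0 hθ
  have i0 := hint (-1) (by simp)
  have i1 := hint (-1 + β) (by simp only [Complex.add_re, Complex.neg_re, Complex.one_re]; linarith)
  have i2 := hint (-1 + starRingEnd ℂ β)
    (by simp only [Complex.add_re, Complex.neg_re, Complex.one_re]; linarith)
  have i3 := hint (-1 + starRingEnd ℂ β + β)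
    (by simp only [Complex.add_re, Complex.neg_re, Complex.one_re]; linarith)
  -- Expanding the weighted square gives four exponentials whose expectations cancel by `e1`, `e2`
  -- and `e3`.
  have hexpand : ∀ ω, ((Real.exp (-Y ω) * Complex.normSq (Complex.exp (β * Y ω) - l) : ℝ) : ℂ) =
      Complex.exp ((-1 + starRingEnd ℂ β + β) * Y ω) -
        l * Complex.exp ((-1 + starRingEnd ℂ β) * Y ω) -
        starRingEnd ℂ l * Complex.exp ((-1 + β) * Y ω) +
        l * starRingEnd ℂ l * Complex.exp ((-1) * Y ω) := by
    intro ω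
    rw [Complex.ofReal_mul, ← Complex.mul_conj, map_sub, ← Complex.exp_conj, map_mul,
      Complex.conj_ofReal, Complex.ofReal_exp]
    have x1 : Complex.exp ((-1 + starRingEnd ℂ β + β) * Y ω) = Complex.exp ((-1) * Y ω) *
        Complex.exp (starRingEnd ℂ β * Y ω) * Complex.exp (β * Y ω) := by
      rw [← Complex.exp_add, ← Complex.exp_add]; ring_nf
    have x2 : Complex.exp ((-1 + starRingEnd ℂ β) * Y ω) = Complex.exp ((-1) * Y ω) *
        Complex.exp (starRingEnd ℂ β * Y ω) := by
      rw [← Complex.exp_add]; ring_nf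
    have x3 : Complex.exp ((-1 + β) * Y ω) = Complex.exp ((-1) * Y ω) *
        Complex.exp (β * Y ω) := by
      rw [← Complex.exp_add]; ring_nf
    have x4 : ((-Y ω : ℝ) : ℂ) = (-1) * Y ω := by push_cast; ring
    rw [x1, x2, x3, x4]
    ring
  have hzeroC : ∫ ω, ((Real.exp (-Y ω) * Complex.normSq (Complex.exp (β * Y ω) - l) : ℝ) : ℂ) ∂P
      = 0 := by
    simp_rw [hexpand]
    have j2 := i3.sub (i2.const_mul l)
    have j1 := j2.sub (i1.const_mul (starRingEnd ℂ l))
    refine (integral_add j1 (i0.const_mul (l * starRingEnd ℂ l))).trans ?_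
    rw [integral_sub' j2 (i1.const_mul _), integral_sub' i3 (i2.const_mul _), integral_const_mul,
      integral_const_mul, integral_const_mul]
    change L (-1 + starRingEnd ℂ β + β) - l * L (-1 + starRingEnd ℂ β) -
      starRingEnd ℂ l * L (-1 + β) + l * starRingEnd ℂ l * L (-1) = 0
    rw [e3, e2, e1]
    ring
  have hintC : Integrable (fun ω =>
      ((Real.exp (-Y ω) * Complex.normSq (Complex.exp (β * Y ω) - l) : ℝ) : ℂ)) P := by
    simp_rw [hexpand]
    exact ((i3.sub (i2.const_mul _)).sub (i1.const_mul _)).add (i0.const_mul _)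
  have hintR : Integrable (fun ω =>
      Real.exp (-Y ω) * Complex.normSq (Complex.exp (β * Y ω) - l)) P := hintC.re
  have hzero : ∫ ω, Real.exp (-Y ω) * Complex.normSq (Complex.exp (β * Y ω) - l) ∂P = 0 := by
    exact Complex.ofReal_eq_zero.1 (integral_ofReal.symm.trans hzeroC)
  rw [integral_eq_zero_iff_of_nonneg
    (fun ω => mul_nonneg (Real.exp_pos _).le (Complex.normSq_nonneg _)) hintR] at hzero
  filter_upwards [hzero] with ω hω
  rcases mul_eq_zero.1 hω with h | h
  · exact absurd h (Real.exp_pos _).ne'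
  · exact sub_eq_zero.1 (Complex.normSq_eq_zero.1 h)

/-- A random variable `Y` for which `exp (β Y)` is almost surely constant for arbitrarily small
nonzero `β` is almost surely constant. -/
lemma exists_ae_eq_const_of_exp_mul {β l : ℕ → ℂ} (hβ0 : ∀ n, β n ≠ 0)
    (hβ : Tendsto β atTop (𝓝 0))
    (h : ∀ᶠ n in atTop, ∀ᵐ ω ∂P, Complex.exp (β n * Y ω) = l n) :
    ∃ y : ℝ, ∀ᵐ ω ∂P, Y ω = y := by
  obtain ⟨N, hN⟩ := eventually_atTop.1 h
  have hall : ∀ᵐ ω ∂P, ∀ n, N ≤ n → Complex.exp (β n * Y ω) = l n := by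
    rw [ae_all_iff]
    intro n
    by_cases hn : N ≤ n
    · filter_upwards [hN n hn] with ω hω using fun _ => hω
    · exact Eventually.of_forall fun ω h => absurd h hn
  obtain ⟨ω₀, hω₀⟩ := hall.exists
  refine ⟨Y ω₀, ?_⟩
  filter_upwards [hall] with ω hω
  have ht : Tendsto (fun n => β n * ((Y ω : ℂ) - Y ω₀)) atTop (𝓝 0) := by
    simpa using hβ.mul_const ((Y ω : ℂ) - Y ω₀)
  have him : Tendsto (fun n => (β n * ((Y ω : ℂ) - Y ω₀)).im) atTop (𝓝 0) :=
    (Complex.continuous_im.tendsto 0).comp ht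
  -- For n large, depending on `ω`, the imaginary part lies in (-π, π), where the principal
  -- logarithm inverts `exp` and no multiple of 2πi can intervene.
  obtain ⟨n, hn, hnN⟩ := ((him.eventually (Ioo_mem_nhds (neg_lt_zero.2 Real.pi_pos)
    Real.pi_pos)).and (eventually_ge_atTop N)).exists
  have hexp : Complex.exp (β n * ((Y ω : ℂ) - Y ω₀)) = 1 := by
    rw [mul_sub, Complex.exp_sub, hω n hnN, hω₀ n hnN, div_self]
    rw [← hω n hnN]
    exact Complex.exp_ne_zero _
  have hz := Complex.log_exp hn.1 hn.2.le
  rw [hexp, Complex.log_one] at hz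
  rcases mul_eq_zero.1 hz.symm with h | h
  · exact absurd h (hβ0 n)
  · exact_mod_cast sub_eq_zero.1 h

end LaplaceTransform

/-! ### Necessity of constant coefficients -/

section Converse

variable {Ω : Type*} [MeasurableSpace Ω] {P : Measure Ω} [IsProbabilityMeasure P]
  {W Z : ℝ≥0 → Ω → ℝ} {a b c : ℝ≥0 → ℝ}

/-- The joint characteristic function of `f s - f 0` and `f t - f s` for the subordinated process
`f`, in terms of the Laplace transforms of `Z s` and `Z t - Z s`. -/
lemma integral_exp_two_increments_subordinatedProcess
    (hW : IsBrownianReal W P) (hZ : IsAdditiveSubordinator Z P)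
    (hWZ : IndepFun (fun ω t => W t ω) (fun ω t => Z t ω) P)
    (ha_pos : ∀ t, 0 < a t) (ha_mono : Monotone a) {s t : ℝ≥0} (hst : s ≤ t) (u v : ℝ) :
    ∫ ω, Complex.exp (Complex.I * ((
        u * (subordinatedProcess W Z a b c s ω - subordinatedProcess W Z a b c 0 ω) +
        v * (subordinatedProcess W Z a b c t ω - subordinatedProcess W Z a b c s ω) : ℝ) : ℂ)) ∂P =
      Complex.exp (Complex.I * u * (c s - c 0)) * Complex.exp (Complex.I * v * (c t - c s)) *
      (complexMGF (Z s) P (-(u : ℂ) ^ 2 / 2 * a s + Complex.I * u * b s +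
        (-(v : ℂ) ^ 2 / 2 * (a t - a s) + Complex.I * v * (b t - b s))) *
      complexMGF (Z t - Z s) P (-(v : ℂ) ^ 2 / 2 * a t + Complex.I * v * b t)) := by
  have hmono : Monotone ![0, s, t] := by
    rw [Fin.monotone_iff_le_succ]
    intro i
    fin_cases i
    · exact zero_le
    · exact hst
  have key := integral_exp_sum_subordinatedProcess_increments (b := b) (c := c) hW hZ hWZ ha_pos
    ha_mono hmono ![u, v]
  simp only [Fin.sum_univ_two, Matrix.cons_val_zero, Matrix.cons_val_one,
    Fin.succ_zero_eq_one, Fin.castSucc_zero, Fin.succ_one_eq_two, Fin.castSucc_one,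
    Matrix.cons_val] at key
  refine key.trans ?_
  have hind : IndepFun (Z s) (Z t - Z s) P :=
    hZ.indepIncrements.indepFun_eval_sub zero_le hst hZ.zero
  have hmul := hind.integral_comp_mul_comp
    (f := fun x : ℝ => Complex.exp ((-(u : ℂ) ^ 2 / 2 * a s + Complex.I * u * b s +
        (-(v : ℂ) ^ 2 / 2 * (a t - a s) + Complex.I * v * (b t - b s))) * x))
    (g := fun x : ℝ => Complex.exp ((-(v : ℂ) ^ 2 / 2 * a t + Complex.I * v * b t) * x))
    (hZ.aemeasurable s) ((hZ.aemeasurable t).sub (hZ.aemeasurable s)) (by fun_prop) (by fun_prop)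
  refine Eq.trans ?_ (congrArg _ hmul)
  rw [← integral_const_mul]
  refine integral_congr_ae ?_
  filter_upwards [hZ.zero] with ω h0
  simp only [Pi.mul_apply, Function.comp_apply, Pi.sub_apply, h0, ← Complex.exp_add]
  congr 1
  push_cast
  ring

/-- Independence equates the joint characteristic function at (u, v) with the product of its values
at (u, 0) and (0, v); the phases from `c` and the transform of Z_t - Z_s then cancel. -/
lemma complexMGF_mul_of_isAdditiveProcess
    (hW : IsBrownianReal W P) (hZ : IsAdditiveSubordinator Z P)
    (hWZ : IndepFun (fun ω t => W t ω) (fun ω t => Z t ω) P)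
    (ha_pos : ∀ t, 0 < a t) (ha_mono : Monotone a)
    (hf : IsAdditiveProcess (subordinatedProcess W Z a b c) P) {s t : ℝ≥0} (hst : s ≤ t)
    (u v : ℝ)
    (hv : complexMGF (Z t - Z s) P (-(v : ℂ) ^ 2 / 2 * a t + Complex.I * v * b t) ≠ 0) :
    complexMGF (Z s) P (-(u : ℂ) ^ 2 / 2 * a s + Complex.I * u * b s +
        (-(v : ℂ) ^ 2 / 2 * (a t - a s) + Complex.I * v * (b t - b s))) =
      complexMGF (Z s) P (-(u : ℂ) ^ 2 / 2 * a s + Complex.I * u * b s) *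
      complexMGF (Z s) P (-(v : ℂ) ^ 2 / 2 * (a t - a s) + Complex.I * v * (b t - b s)) := by
  have hJ := integral_exp_two_increments_subordinatedProcess (b := b) (c := c) hW hZ hWZ ha_pos
    ha_mono hst
  have hind := hf.indepIncrements.indepFun_sub_sub (zero_le (a := s)) hst
  have hmul := hind.integral_comp_mul_comp
    (f := fun x : ℝ => Complex.exp (Complex.I * ((u * x : ℝ) : ℂ)))
    (g := fun x : ℝ => Complex.exp (Complex.I * ((v * x : ℝ) : ℂ)))
    ((hf.aemeasurable s).sub (hf.aemeasurable 0)) ((hf.aemeasurable t).sub (hf.aemeasurable s))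
    (by fun_prop) (by fun_prop)
  have hJu := hJ u 0
  have hJv := hJ 0 v
  have hJuv := hJ u v
  simp only [Pi.mul_apply, Function.comp_apply, Pi.sub_apply, ← Complex.exp_add, ← mul_add,
    ← Complex.ofReal_add] at hmul
  simp only [zero_mul, add_zero, zero_add, Complex.ofReal_zero, mul_zero, ne_eq,
    OfNat.ofNat_ne_zero, not_false_eq_true, zero_pow, neg_zero, zero_div, Complex.exp_zero,
    one_mul, mul_one] at hJu hJv
  rw [hJuv, hJu, hJv] at hmul
  have h1 : complexMGF (Z t - Z s) P 0 = 1 := by simp [complexMGF]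
  rw [h1] at hmul
  have hx := Complex.exp_ne_zero (Complex.I * u * (c s - c 0))
  have hy := Complex.exp_ne_zero (Complex.I * v * (c t - c s))
  refine mul_left_cancel₀ hx (mul_left_cancel₀ hy (mul_right_cancel₀ hv ?_))
  linear_combination hmul

/-- If the subordinated process is additive and `Z s` is not almost surely constant, then the
coefficients do not change after time `s`. -/
lemma coefficients_eq_of_isAdditiveProcess
    (hW : IsBrownianReal W P) (hZ : IsAdditiveSubordinator Z P)
    (hWZ : IndepFun (fun ω t => W t ω) (fun ω t => Z t ω) P)
    (ha_pos : ∀ t, 0 < a t) (ha_mono : Monotone a)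
    (hf : IsAdditiveProcess (subordinatedProcess W Z a b c) P) {s t : ℝ≥0} (hst : s ≤ t)
    (hs : ¬ ∃ z : ℝ, ∀ᵐ ω ∂P, Z s ω = z) : a s = a t ∧ b s = b t := by
  by_contra hne
  apply hs
  let β : ℝ → ℂ := fun v => -(v : ℂ) ^ 2 / 2 * (a t - a s) + Complex.I * v * (b t - b s)
  let γ : ℝ → ℂ := fun v => -(v : ℂ) ^ 2 / 2 * a t + Complex.I * v * b t
  have hβ : ∀ v, β v = -(v : ℂ) ^ 2 / 2 * ((a t - a s : ℝ) : ℂ) +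
      Complex.I * v * ((b t - b s : ℝ) : ℂ) := by
    intro v
    simp only [β]
    push_cast
    rfl
  have hβre : ∀ v, (β v).re = -v ^ 2 / 2 * (a t - a s) := fun v => by
    rw [hβ, re_gaussian_exponent]
  have hβim : ∀ v, (β v).im = v * (b t - b s) := fun v => by
    rw [hβ, im_gaussian_exponent]
  have hγre : ∀ v, (γ v).re = -v ^ 2 / 2 * a t := fun v => re_gaussian_exponent _ _ _
  have hβ0 : β 0 = 0 := by simp [β]
  have hγ0 : γ 0 = 0 := by simp [γ]
  have hβcont : Continuous β := by fun_prop
  have hγcont : Continuous γ := by fun_prop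
  let v : ℕ → ℝ := fun n => 1 / ((n : ℝ) + 1)
  have hv : Tendsto v atTop (𝓝 0) := tendsto_one_div_add_atTop_nhds_zero_nat
  have hvpos : ∀ n, 0 < v n := fun n => Nat.one_div_pos_of_nat
  -- The transform of Z_t - Z_s tends to 1, hence is eventually nonzero, as cancellation requires.
  have hM : Tendsto (fun n => complexMGF (Z t - Z s) P (γ (v n))) atTop (𝓝 1) := by
    have h1 : (1 : ℂ) = ∫ _, (1 : ℂ) ∂P := by simp
    rw [h1]
    have hm : AEMeasurable (Z t - Z s) P := (hZ.aemeasurable t).sub (hZ.aemeasurable s)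
    refine tendsto_integral_of_dominated_convergence (fun _ => 1)
      (fun n => by fun_prop) (integrable_const _) (fun n => ?_) (Eventually.of_forall fun ω => ?_)
    · filter_upwards [hZ.monotone] with ω hω
      refine norm_exp_mul_le_one ?_ (sub_nonneg.2 (hω hst))
      rw [hγre]
      have := mul_nonneg (sq_nonneg (v n)) (ha_pos t).le
      linarith
    · have h2 : Tendsto (fun n => γ (v n) * ((Z t - Z s) ω : ℝ)) atTop (𝓝 0) := by
        have := ((hγcont.tendsto 0).comp hv).mul_const (((Z t - Z s) ω : ℝ) : ℂ)
        rwa [hγ0, zero_mul] at this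
      have h3 := (Complex.continuous_exp.tendsto _).comp h2
      rwa [Complex.exp_zero] at h3
  refine exists_ae_eq_const_of_exp_mul (β := fun n => β (v n))
    (l := fun n => complexMGF (Z s) P (β (v n))) (fun n h0 => hne ?_) ?_ ?_
  · have hre := hβre (v n)
    have him := hβim (v n)
    rw [h0] at hre him
    simp only [Complex.zero_re, Complex.zero_im] at hre him
    have hvn := hvpos n
    have h1 : a t - a s = 0 := by
      rcases mul_eq_zero.1 hre.symm with h | h
      · have := pow_pos hvn 2
        linarith
      · exact h
    have h2 : b t - b s = 0 := (mul_eq_zero.1 him.symm).resolve_left hvn.ne'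
    exact ⟨by linarith, by linarith⟩
  · have := (hβcont.tendsto 0).comp hv
    rwa [hβ0] at this
  · filter_upwards [hM.eventually_ne one_ne_zero] with n hn
    refine ae_exp_mul_eq_complexMGF (hZ.aemeasurable s) ?_ ?_ (ha_pos s) (b := b s) fun u => ?_
    · filter_upwards [hZ.nonneg] with ω hω using hω s
    · rw [hβre]
      have := mul_nonneg (sq_nonneg (v n)) (sub_nonneg.2 (ha_mono hst))
      linarith
    · exact complexMGF_mul_of_isAdditiveProcess hW hZ hWZ ha_pos ha_mono hf hst u (v n) hn

end Converse

/-- Z_0 is degenerate, so time 0 is out of reach of the probabilistic argument and is recovered by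
continuity. -/
lemma isConstantInTime_of_eq_of_pos {a : ℝ≥0 → ℝ} (ha : Continuous a)
    (h : ∀ s t, 0 < s → s ≤ t → a s = a t) : IsConstantInTime a := by
  refine ⟨a 1, fun t => ?_⟩
  have hIoi : Set.EqOn a (fun _ => a 1) (Set.Ioi 0) := by
    intro t ht
    rcases le_total t 1 with h1 | h1
    · exact h t 1 ht h1
    · exact (h 1 t one_pos h1).symm
  have := hIoi.closure ha continuous_const
  rw [closure_Ioi] at this
  exact this (Set.mem_Ici.2 zero_le)

theorem mainTheorem2 {Ω : Type*} [MeasurableSpace Ω] (P : Measure Ω) [IsProbabilityMeasure P]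
    (W Z : ℝ≥0 → Ω → ℝ) (hW : IsBrownianReal W P) (hZ : IsAdditiveSubordinator Z P)
    (hWZ : IndepFun (fun ω t => W t ω) (fun ω t => Z t ω) P)
    (a b c : ℝ≥0 → ℝ) (ha_pos : ∀ t, 0 < a t) (ha_mono : Monotone a) (ha_cont : Continuous a)
    (hb_cont : Continuous b) (hc_cont : Continuous c) (hc_zero : c 0 = 0) :
    (IsConstantInTime a ∧ IsConstantInTime b →
      IsAdditiveProcess (subordinatedProcess W Z a b c) P) ∧
    (IsNondeterministic Z P →
      (IsAdditiveProcess (subordinatedProcess W Z a b c) P ↔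
        IsConstantInTime a ∧ IsConstantInTime b)) := by
  have hconst : IsConstantInTime a ∧ IsConstantInTime b →
      IsAdditiveProcess (subordinatedProcess W Z a b c) P := by
    rintro ⟨⟨a₀, ha₀⟩, ⟨b₀, hb₀⟩⟩
    obtain rfl : a = fun _ => a₀ := funext ha₀
    obtain rfl : b = fun _ => b₀ := funext hb₀
    exact isAdditiveProcess_subordinatedProcess_const hW hZ hWZ b₀ (ha_pos 0) hc_cont hc_zero
  refine ⟨hconst, fun hnd => ⟨fun hf => ?_, hconst⟩⟩
  have hcoef : ∀ s t, 0 < s → s ≤ t → a s = a t ∧ b s = b t := fun s t hs hst =>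
    coefficients_eq_of_isAdditiveProcess hW hZ hWZ ha_pos ha_mono hf hst (hnd s hs)
  exact ⟨isConstantInTime_of_eq_of_pos ha_cont fun s t hs hst => (hcoef s t hs hst).1,
    isConstantInTime_of_eq_of_pos hb_cont fun s t hs hst => (hcoef s t hs hst).2⟩
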